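/- Fix integers $d\ge 2$ and $1\le \ell\le d-1$ and let $\rho>0$. Let $\mathcal W_{d,\rho}$ be the Poisson-Voronoi tessellation of intensity $\rho$ in $\mathbb R^d$, that is, the collection of the Voronoi cells $$V(x,\zeta)=\{w\in\mathbb R^d:\ \|x-w\|\le\|y-w\|\text{ for all }y\in\zeta\},\qquad x\in\zeta,$$ of a homogeneous Poisson point process $\zeta$ on $\mathbb R^d$ with intensity $\rho$. Identify $\mathbb R^\ell$ with the linear subspace of $\mathbb R^d$ spanned by the first $\ell$ standard basis vectors, and let $\mathcal W_{d,\rho}\cap\mathbb R^\ell$ be the collection of all non-empty sets $C\cap\mathbb R^\ell$, $C\in\mathcal W_{d,\rho}$. For $\beta>-1$ and $\gamma>0$ let $\eta_{\ell,\beta,\gamma}$ be a Poisson point process on $\mathbb R^\ell\times[0,\infty)$ whose intensity measure has density $$(v,h)\mapsto \gamma\,c_{\ell+1,\beta}\,h^\beta,\qquad c_{\ell+1,\beta}=\frac{\Gamma\left(\frac{\ell+1}{2}+\beta+1\right)}{\pi^{\frac{\ell+1}{2}}\,\Gamma(\beta+1)},$$ with respect to Lebesgue measure, and let the $\beta$-Voronoi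 tessellation $\mathcal V_{\ell,\beta,\gamma}$ be its Laguerre diagram, that is, the collection of all non-empty cells $$\{w\in\mathbb R^\ell:\ \|w-v\|^2+h\le\|w-v'\|^2+h'\text{ for all }(v',h')\in\eta_{\ell,\beta,\gamma}\},\qquad (v,h)\in\eta_{\ell,\beta,\gamma}.$$ Then $\mathcal W_{d,\rho}\cap\mathbb R^\ell$ has the same distribution as $\mathcal V_{\ell,\beta,\gamma}$ with $$\beta=\frac{d-\ell}{2}-1,\qquad \gamma=\frac{\pi^{\frac{d+1}{2}}\,\rho}{\Gamma\left(\frac{d+1}{2}\right)}.$$ Here random tessellations are regarded as random collections of closed sets (the cells), where the space of such collections carries the usual $\sigma$-algebra of particle processes: closed sets carry the Borel $\sigma$-algebra of the Fell topology, and collections carry the $\sigma$-algebra generated by the numbers of members in measurable families of closed sets. -/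

import Mathlib

open MeasureTheory ProbabilityTheory TopologicalSpace

namespace SectionTess

/-- Euclidean `n`-space. -/
abbrev E (n : ℕ) : Type := EuclideanSpace ℝ (Fin n)

section PointProcesses

variable {S Ω : Type*} [MetricSpace S] [MeasurableSpace S] [MeasurableSpace Ω]

/-- A (simple) point process in `S`, identified with its random set of atoms: every realization is
locally finite and the number of atoms in each measurable set is a random variable. -/
structure IsPointProcess (ξ : Ω → Set S) : Prop where
  finite_inter : ∀ ω, ∀ B : Set S, Bornology.IsBounded B → (ξ ω ∩ B).Finite
  measurable_count : ∀ B : Set S, MeasurableSet B → Measurable fun ω => (ξ ω ∩ B).encard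

/-- `ξ` is a (simple) Poisson point process with intensity measure `μ` under `P`: the number of
atoms in a measurable set of finite intensity is Poisson distributed with mean the intensity of
that set, and the numbers of atoms in pairwise disjoint measurable sets are independent. -/
structure IsPoissonProcess (ξ : Ω → Set S) (μ : Measure S) (P : Measure Ω) : Prop
    extends IsPointProcess ξ where
  map_count : ∀ B : Set S, MeasurableSet B → μ B ≠ ⊤ →
    P.map (fun ω => (ξ ω ∩ B).encard) =
      (poissonMeasure (μ B).toNNReal).map (fun k : ℕ => (k : ℕ∞))
  indep_count : ∀ (n : ℕ) (B : Fin n → Set S), (∀ i, MeasurableSet (B i)) →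
    Pairwise (fun i j => Disjoint (B i) (B j)) →
    iIndepFun (fun i ω => (ξ ω ∩ B i).encard) P

end PointProcesses

/-- The Borel σ-algebra of the Fell topology on the closed subsets of Euclidean space, generated by
the families of all closed sets that hit a given compact set. -/
@[reducible] def fellMeasurableSpace (n : ℕ) : MeasurableSpace (Closeds (E n)) :=
  MeasurableSpace.generateFrom
    {A | ∃ K : Set (E n), IsCompact K ∧ A = {F : Closeds (E n) | ((F : Set (E n)) ∩ K).Nonempty}}

/-- A collection of closed subsets (cells) of Euclidean space. A realization of a random
tessellation, regarded as a particle process identified with its support, is such a collection. -/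
@[ext]
structure Mosaic (n : ℕ) where
  cells : Set (Closeds (E n))

/-- The usual σ-algebra for particle processes: it is generated by the numbers of cells that lie in
a measurable family of closed sets. -/
noncomputable instance (n : ℕ) : MeasurableSpace (Mosaic n) :=
  ⨆ A : {A : Set (Closeds (E n)) // MeasurableSet[fellMeasurableSpace n] A},
    MeasurableSpace.comap (fun T : Mosaic n => (T.cells ∩ A.1).encard) inferInstance

/-- The Voronoi cell of `x` with respect to `Y`. -/
def voronoiCell {n : ℕ} (x : E n) (Y : Set (E n)) : Closeds (E n) where
  carrier := {w | ∀ y ∈ Y, ‖x - w‖ ≤ ‖y - w‖}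
  isClosed' := by
    simp only [Set.ofPred_forall]
    exact isClosed_biInter fun y _ => isClosed_le (by fun_prop) (by fun_prop)

/-- The Voronoi diagram of `Y`: the collection of the Voronoi cells of all points of `Y`. -/
def voronoiDiagram {n : ℕ} (Y : Set (E n)) : Mosaic n where
  cells := {C | ∃ x ∈ Y, C = voronoiCell x Y}

/-- The power of `w` with respect to the weighted point `p = (v, h)`. -/
noncomputable def power {n : ℕ} (w : E n) (p : E n × ℝ) : ℝ := ‖w - p.1‖ ^ 2 + p.2

/-- The Laguerre cell of the weighted point `p` with respect to `X`. -/
def laguerreCell {n : ℕ} (p : E n × ℝ) (X : Set (E n × ℝ)) : Closeds (E n) where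
  carrier := {w | ∀ q ∈ X, power w p ≤ power w q}
  isClosed' := by
    simp only [Set.ofPred_forall, power]
    exact isClosed_biInter fun y _ => isClosed_le (by fun_prop) (by fun_prop)

/-- The Laguerre diagram of `X`: the collection of all nonempty Laguerre cells. -/
def laguerreDiagram {n : ℕ} (X : Set (E n × ℝ)) : Mosaic n where
  cells := {C | (C : Set (E n)).Nonempty ∧ ∃ p ∈ X, C = laguerreCell p X}

/-- The embedding of `ℝ^l` into `ℝ^d` as the span of the first `l` standard basis vectors
(for `l ≤ d`): `(x₁, …, x_l) ↦ (x₁, …, x_l, 0, …, 0)`. -/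
noncomputable def embed (l d : ℕ) (v : E l) : E d :=
  WithLp.toLp 2 fun i : Fin d => if h : (i : ℕ) < l then v ⟨i, h⟩ else 0

theorem continuous_embed (l d : ℕ) : Continuous (embed l d) := by
  unfold embed
  refine (PiLp.continuous_toLp 2 _).comp (continuous_pi fun i => ?_)
  split_ifs
  · fun_prop
  · fun_prop

/-- The intersection of a collection of cells in `ℝ^d` with `ℝ^l`: the collection of all nonempty
intersections of its cells with `ℝ^l`, as subsets of `ℝ^l`. -/
def sectionMosaic (l : ℕ) {d : ℕ} (T : Mosaic d) : Mosaic l where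
  cells := {D | (D : Set (E l)).Nonempty ∧
    ∃ C ∈ T.cells, (D : Set (E l)) = embed l d ⁻¹' (C : Set (E d))}

/-- The constant `c_{n,β} = Γ(n/2 + β + 1) / (π^{n/2} Γ(β + 1))`. -/
noncomputable def betaConst (n : ℕ) (β : ℝ) : ℝ :=
  Real.Gamma ((n : ℝ) / 2 + β + 1) / (Real.pi ^ ((n : ℝ) / 2) * Real.Gamma (β + 1))

/-- The measure on `ℝ^n × [0, ∞)` with Lebesgue density `(v, h) ↦ γ c_{n+1,β} h^β`; for `β > -1` and
`γ > 0` it is the intensity measure of the Poisson process behind the `β`-Voronoi tessellation. -/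
noncomputable def betaIntensity (n : ℕ) (β γ : ℝ) : Measure (E n × ℝ) :=
  ((volume : Measure (E n × ℝ)).restrict (Set.univ ×ˢ Set.Ici 0)).withDensity
    fun p => ENNReal.ofReal (γ * betaConst (n + 1) β * p.2 ^ β)

/-- `T` is a Poisson-Voronoi tessellation of intensity `ρ` in `ℝ^n`: the Voronoi diagram of a
homogeneous Poisson process with intensity `ρ`. -/
def IsPoissonVoronoi {Ω : Type*} [MeasurableSpace Ω] (n : ℕ) (ρ : ℝ) (T : Ω → Mosaic n)
    (P : Measure Ω) : Prop :=
  ∃ ζ : Ω → Set (E n), IsPoissonProcess ζ (ENNReal.ofReal ρ • (volume : Measure (E n))) P ∧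
    ∀ ω, T ω = voronoiDiagram (ζ ω)

/-- `T` is a `β`-Voronoi tessellation in `ℝ^n` with parameters `β > -1` and `γ > 0`: the Laguerre
diagram of a Poisson process with intensity measure `betaIntensity n β γ`. -/
def IsBetaVoronoi {Ω : Type*} [MeasurableSpace Ω] (n : ℕ) (β γ : ℝ) (T : Ω → Mosaic n)
    (P : Measure Ω) : Prop :=
  ∃ η : Ω → Set (E n × ℝ), IsPoissonProcess η (betaIntensity n β γ) P ∧
    ∀ ω, T ω = laguerreDiagram (η ω)

end SectionTess

namespace SectionTess

/-! Write `d = l + m` and split `x = (v, u)` with `v ∈ ℝ^l`, `u ∈ ℝ^m`. By Pythagoras, `‖x - w‖² =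
‖v - w‖² + ‖u‖²` for `w ∈ ℝ^l`, so the section of a Voronoi diagram is exactly the Laguerre diagram
of the weighted points `(v, ‖u‖²)` (`sectionMosaic_voronoiDiagram`). This map pushes `ρ` times
Lebesgue measure to the `β`-intensity (`map_weightedPoint`).

It remains to compare laws. The map need not be injective, but only the set of image points matters.
Void probabilities determine the law of a locally finite set, by a π-system argument in the spirit
of Rényi's theorem (`identDistrib_of_void`). The image misses `B` iff `ζ` misses the preimage of
`B`, so the void probabilities agree. Equality of laws then passes to the tessellations because the
Laguerre diagram is a measurable function of the configuration (`measurable_laguerreDiagram`), which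
is the technical bulk of the proof. -/

/-- A locally finite subset of a metric space. -/
@[ext]
structure Configuration (S : Type*) [MetricSpace S] where
  carrier : Set S
  finite_inter : ∀ B : Set S, Bornology.IsBounded B → (carrier ∩ B).Finite

/-! ### Void events and the law of a random locally finite set. -/

section Configuration

variable {S Ω : Type*} [MetricSpace S] [MeasurableSpace S] [MeasurableSpace Ω]

/-- The void events of bounded measurable sets. -/
def voidEvents (S : Type*) [MetricSpace S] [MeasurableSpace S] : Set (Set (Configuration S)) :=
  {A | ∃ B : Set S, MeasurableSet B ∧ Bornology.IsBounded B ∧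
    A = {X : Configuration S | X.carrier ∩ B = ∅}}

/-- The σ-algebra on configurations generated by the void events. -/
instance : MeasurableSpace (Configuration S) := MeasurableSpace.generateFrom (voidEvents S)

theorem isPiSystem_voidEvents : IsPiSystem (voidEvents S) := by
  rintro _ ⟨B, hB, hb, rfl⟩ _ ⟨C, hC, hc, rfl⟩ -
  refine ⟨B ∪ C, hB.union hC, hb.union hc, ?_⟩
  ext X
  simp [Set.inter_union_distrib_left]

theorem measurableSet_hit {B : Set S} (hB : MeasurableSet B) (hb : Bornology.IsBounded B) :
    MeasurableSet {X : Configuration S | (X.carrier ∩ B).Nonempty} := by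
  have : MeasurableSet {X : Configuration S | X.carrier ∩ B = ∅} :=
    MeasurableSpace.measurableSet_generateFrom ⟨B, hB, hb, rfl⟩
  convert this.compl using 1
  ext X
  simp [Set.nonempty_iff_ne_empty]

/-- Only void events have to be pulled back, and the image misses `B` iff `ξ` misses `f ⁻¹' B`.
Hence `f` need not be injective. -/
theorem IsPointProcess.measurable_image {T : Type*} [MetricSpace T] [MeasurableSpace T]
    {ξ : Ω → Set S} (hξ : IsPointProcess ξ) {f : S → T} (hf : Measurable f)
    (h : ∀ ω, ∀ B : Set T, Bornology.IsBounded B → (f '' ξ ω ∩ B).Finite) :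
    Measurable fun ω => (⟨f '' ξ ω, h ω⟩ : Configuration T) := by
  refine measurable_generateFrom ?_
  rintro _ ⟨B, hB, hb, rfl⟩
  convert hξ.measurable_count (f ⁻¹' B) (hf hB) (measurableSet_singleton 0) using 1
  ext ω
  simp [Set.eq_empty_iff_forall_notMem]

theorem IsPoissonProcess.measure_void {ξ : Ω → Set S} {μ : Measure S} {P : Measure Ω}
    (hξ : IsPoissonProcess ξ μ P) {B : Set S} (hB : MeasurableSet B) (hμ : μ B ≠ ⊤) :
    P {ω | ξ ω ∩ B = ∅} = ENNReal.ofReal (Real.exp (-(μ B).toReal)) := by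
  have h := congrArg (fun ν => ν {0}) (hξ.map_count B hB hμ)
  rw [Measure.map_apply (hξ.measurable_count B hB) (measurableSet_singleton 0),
    Measure.map_apply .of_discrete (measurableSet_singleton 0)] at h
  have h0 : ((fun k : ℕ => (k : ℕ∞)) ⁻¹' {0}) = {0} := by ext; simp
  rw [h0, poissonMeasure_singleton] at h
  have h1 : (fun ω => (ξ ω ∩ B).encard) ⁻¹' {0} = {ω | ξ ω ∩ B = ∅} := by ext; simp
  rw [h1] at h
  rw [h]
  simp [ENNReal.coe_toNNReal_eq_toReal]

/-- Two measurable configurations with the same void probabilities are identically distributed. -/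
theorem identDistrib_of_void {Ω' : Type*} [MeasurableSpace Ω'] {P : Measure Ω} {P' : Measure Ω'}
    [IsProbabilityMeasure P] [IsProbabilityMeasure P']
    {X : Ω → Configuration S} {Y : Ω' → Configuration S} (hX : Measurable X) (hY : Measurable Y)
    (h : ∀ B : Set S, MeasurableSet B → Bornology.IsBounded B →
      P {ω | (X ω).carrier ∩ B = ∅} = P' {ω | (Y ω).carrier ∩ B = ∅}) :
    IdentDistrib X Y P P' := by
  refine ⟨hX.aemeasurable, hY.aemeasurable, ?_⟩
  have := Measure.isProbabilityMeasure_map (μ := P) hX.aemeasurable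
  have := Measure.isProbabilityMeasure_map (μ := P') hY.aemeasurable
  refine ext_of_generate_finite (voidEvents S) rfl isPiSystem_voidEvents ?_ (by simp)
  rintro _ ⟨B, hB, hb, rfl⟩
  have hA : MeasurableSet {X : Configuration S | X.carrier ∩ B = ∅} :=
    MeasurableSpace.measurableSet_generateFrom ⟨B, hB, hb, rfl⟩
  rw [Measure.map_apply hX hA, Measure.map_apply hY hA]
  exact h B hB hb

end Configuration

/-! ### Measurable enumeration of the points of a configuration. -/

section Enumeration

variable {S : Type*} [MetricSpace S] {e : S → ℝ}

/-- The part of the shell `k ≤ dist x o < k + 1` in which the coordinate `e` is at least `r`. -/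
def shellAbove (o : S) (e : S → ℝ) (i : ℕ × ℚ) : Set S :=
  {x | (i.1 : ℝ) ≤ dist x o ∧ dist x o < i.1 + 1 ∧ (i.2 : ℝ) ≤ e x}

theorem measurableSet_shellAbove [MeasurableSpace S] [BorelSpace S] (o : S) (he : Measurable e) (i : ℕ × ℚ) :
    MeasurableSet (shellAbove o e i) := by
  have hd : Measurable fun x : S => dist x o := (continuous_id.dist continuous_const).measurable
  exact (measurableSet_le measurable_const hd).inter
    ((measurableSet_lt hd measurable_const).inter (measurableSet_le measurable_const he))

theorem isBounded_shellAbove (o : S) (e : S → ℝ) (i : ℕ × ℚ) :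
    Bornology.IsBounded (shellAbove o e i) :=
  Metric.isBounded_ball.subset fun _ hx => Metric.mem_ball.2 hx.2.1

/-- The point of the configuration in `shellAbove o e i` with the smallest coordinate. -/
noncomputable def pointAt [Nonempty S] (o : S) (e : S → ℝ) (i : ℕ × ℚ) (X : Configuration S) : S :=
  Function.invFun e (sInf (e '' (X.carrier ∩ shellAbove o e i)))

theorem pointAt_eq [Nonempty S] (o : S) (he : Function.Injective e) (i : ℕ × ℚ) (X : Configuration S) {x : S}
    (hx : x ∈ X.carrier ∩ shellAbove o e i)
    (hmin : ∀ y ∈ X.carrier ∩ shellAbove o e i, e x ≤ e y) : pointAt o e i X = x := by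
  have : IsLeast (e '' (X.carrier ∩ shellAbove o e i)) (e x) :=
    ⟨⟨x, hx, rfl⟩, by rintro _ ⟨y, hy, rfl⟩; exact hmin y hy⟩
  rw [pointAt, this.csInf_eq, Function.leftInverse_invFun he]

theorem pointAt_mem [Nonempty S] (o : S) (he : Function.Injective e) (i : ℕ × ℚ) (X : Configuration S)
    (h : (X.carrier ∩ shellAbove o e i).Nonempty) :
    pointAt o e i X ∈ X.carrier ∩ shellAbove o e i ∧
      ∀ y ∈ X.carrier ∩ shellAbove o e i, e (pointAt o e i X) ≤ e y := by
  obtain ⟨x, hx, hmin⟩ :=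
    (X.finite_inter _ (isBounded_shellAbove o e i)).exists_minimalFor e _ h
  have hmin' : ∀ y ∈ X.carrier ∩ shellAbove o e i, e x ≤ e y := fun y hy =>
    (le_total (e x) (e y)).elim id fun hle => hmin hy hle
  rw [pointAt_eq o he i X hx hmin']
  exact ⟨hx, hmin'⟩

/-- Local finiteness leaves a gap just below `e x` among the coordinates of the points near `x`. A
rational threshold in that gap makes `x` the lowest point of its shell above the threshold. So the
countable index set `ℕ × ℚ` reaches every point. -/
theorem exists_pointAt_eq [Nonempty S] (o : S) (he : Function.Injective e) (X : Configuration S) {x : S}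
    (hx : x ∈ X.carrier) :
    ∃ i, (X.carrier ∩ shellAbove o e i).Nonempty ∧ pointAt o e i X = x := by
  set k := ⌊dist x o⌋₊ with hk
  have h1 : (k : ℝ) ≤ dist x o := Nat.floor_le dist_nonneg
  have h2 : dist x o < k + 1 := Nat.lt_floor_add_one _
  have hfin := ((X.finite_inter _ (Metric.isBounded_ball (x := o) (r := k + 1))).image e).inter_of_left
    (Set.Iio (e x))
  obtain ⟨a, ha, hb⟩ : ∃ a < e x, ∀ b ∈ e '' (X.carrier ∩ Metric.ball o (k + 1)) ∩ Set.Iio (e x),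
      b ≤ a := by
    rcases Set.eq_empty_or_nonempty
      (e '' (X.carrier ∩ Metric.ball o (k + 1)) ∩ Set.Iio (e x)) with h | h
    · exact ⟨e x - 1, by linarith, by simp [h]⟩
    · obtain ⟨a, ha, hmax⟩ := Set.exists_max_image _ id hfin h
      exact ⟨a, ha.2, hmax⟩
  obtain ⟨r, hr1, hr2⟩ := exists_rat_btwn ha
  have hmem : x ∈ X.carrier ∩ shellAbove o e (k, r) := ⟨hx, h1, h2, hr2.le⟩
  refine ⟨(k, r), ⟨x, hmem⟩, pointAt_eq o he _ X hmem fun y hy => ?_⟩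
  by_contra! hlt
  have := hb (e y) ⟨⟨y, ⟨hy.1, hy.2.2.1⟩, rfl⟩, hlt⟩
  have := hy.2.2.2
  simp only at this
  linarith

theorem measurableSet_hit_shellAbove [MeasurableSpace S] [BorelSpace S] (o : S)
    (he : Measurable e) (i : ℕ × ℚ) :
    MeasurableSet {X : Configuration S | (X.carrier ∩ shellAbove o e i).Nonempty} :=
  measurableSet_hit (measurableSet_shellAbove o he i) (isBounded_shellAbove o e i)

theorem measurable_pointAt [MeasurableSpace S] [BorelSpace S] [Nonempty S] (o : S)
    (he : MeasurableEmbedding e) (i : ℕ × ℚ) :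
    Measurable (pointAt o e i) := by
  have hs := measurableSet_hit_shellAbove o he.measurable i
  refine measurable_of_restrict_of_restrict_compl hs ?_ ?_
  -- The minimal coordinate is below `a` iff the configuration hits the part of the shell with
  -- coordinate below `a`, which is a hitting event.
  · rw [← he.measurable_comp_iff]
    refine measurable_of_Iio fun a => ?_
    have hB : MeasurableSet (shellAbove o e i ∩ e ⁻¹' Set.Iio a) :=
      (measurableSet_shellAbove o he.measurable i).inter (he.measurable measurableSet_Iio)
    convert measurable_subtype_coe
      (measurableSet_hit hB ((isBounded_shellAbove o e i).subset Set.inter_subset_left)) using 1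
    ext ⟨X, hX⟩
    obtain ⟨hm, hmin⟩ := pointAt_mem o he.injective i X hX
    simp only [Set.mem_preimage, Function.comp_apply, Set.domRestrict_apply, Set.mem_Iio,
      Set.mem_ofPred_eq]
    constructor
    · intro h
      exact ⟨_, hm.1, hm.2, h⟩
    · rintro ⟨y, hy1, hy2, hy3⟩
      exact (hmin y ⟨hy1, hy2⟩).trans_lt hy3
  -- When no point is available, `pointAt` takes a fixed default value.
  · convert measurable_const (a := Function.invFun e (sInf ∅)) using 1
    ext ⟨X, hX⟩
    simp [pointAt, Set.not_nonempty_iff_eq_empty.1 hX]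

theorem carrier_eq_image_pointAt [Nonempty S] (o : S) (he : Function.Injective e) (X : Configuration S) :
    X.carrier = (fun i => pointAt o e i X) '' {i | (X.carrier ∩ shellAbove o e i).Nonempty} := by
  ext x
  constructor
  · intro hx
    obtain ⟨i, hi, rfl⟩ := exists_pointAt_eq o he X hx
    exact ⟨i, hi, rfl⟩
  · rintro ⟨i, hi, rfl⟩
    exact (pointAt_mem o he i X hi).1.1

end Enumeration

/-! ### Measurability of random closed sets and of their number. -/

section Fell

variable {Ω : Type*} [MeasurableSpace Ω] {n : ℕ}

/-- The closed sets that hit a given set. -/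
def hitting (K : Set (E n)) : Set (Closeds (E n)) := {F | ((F : Set (E n)) ∩ K).Nonempty}

theorem measurableSet_hitting {K : Set (E n)} (hK : IsCompact K) :
    MeasurableSet[fellMeasurableSpace n] (hitting K) :=
  MeasurableSpace.measurableSet_generateFrom ⟨K, hK, rfl⟩

/-- Countably many compact test sets separate closed sets. This makes equality of two random cells
an event, as is needed to count distinct cells. -/
theorem eq_of_hitting_closedBall {F G : Closeds (E n)}
    (h : ∀ i j : ℕ, F ∈ hitting (Metric.closedBall (denseSeq (E n) i) (1 / (j + 1))) ↔
      G ∈ hitting (Metric.closedBall (denseSeq (E n) i) (1 / (j + 1)))) : F = G := by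
  have key : ∀ F G : Closeds (E n), (∀ i j : ℕ,
      F ∈ hitting (Metric.closedBall (denseSeq (E n) i) (1 / (j + 1))) →
      G ∈ hitting (Metric.closedBall (denseSeq (E n) i) (1 / (j + 1)))) →
      (F : Set (E n)) ⊆ G := by
    intro F G h x hx
    rw [← G.isClosed.closure_eq, Metric.mem_closure_iff]
    intro ε hε
    obtain ⟨j, hj⟩ := exists_nat_one_div_lt (half_pos hε)
    obtain ⟨i, hi⟩ := (denseRange_denseSeq (E n)).exists_dist_lt x
      (show (0 : ℝ) < 1 / ((j : ℝ) + 1) by positivity)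
    obtain ⟨y, hy, hyb⟩ := h i j ⟨x, hx, hi.le⟩
    refine ⟨y, hy, ?_⟩
    have := dist_triangle_right x y (denseSeq (E n) i)
    have := Metric.mem_closedBall.1 hyb
    linarith
  exact SetLike.coe_injective (Set.Subset.antisymm (key F G fun i j => (h i j).1)
    (key G F fun i j => (h i j).2))

theorem measurableSet_eq_closeds {F G : Ω → Closeds (E n)}
    (hF : Measurable[_, fellMeasurableSpace n] F) (hG : Measurable[_, fellMeasurableSpace n] G) :
    MeasurableSet {ω | F ω = G ω} := by
  have : {ω | F ω = G ω} = ⋂ i : ℕ, ⋂ j : ℕ,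
      {ω | F ω ∈ hitting (Metric.closedBall (denseSeq (E n) i) (1 / (j + 1))) ↔
        G ω ∈ hitting (Metric.closedBall (denseSeq (E n) i) (1 / (j + 1)))} := by
    ext ω
    simp only [Set.mem_iInter, Set.mem_ofPred_eq]
    exact ⟨fun h i j => by rw [h], eq_of_hitting_closedBall⟩
  rw [this]
  refine MeasurableSet.iInter fun i => MeasurableSet.iInter fun j => MeasurableSet.iff ?_ ?_
  · exact hF (measurableSet_hitting (isCompact_closedBall _ _))
  · exact hG (measurableSet_hitting (isCompact_closedBall _ _))

theorem measurableSet_nonempty_closeds :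
    MeasurableSet[fellMeasurableSpace n] {F : Closeds (E n) | (F : Set (E n)).Nonempty} := by
  have : {F : Closeds (E n) | (F : Set (E n)).Nonempty} =
      ⋃ k : ℕ, hitting (Metric.closedBall (0 : E n) k) := by
    ext F
    simp only [Set.mem_iUnion, hitting, Set.mem_ofPred_eq]
    constructor
    · rintro ⟨x, hx⟩
      obtain ⟨k, hk⟩ := exists_nat_ge ‖x‖
      exact ⟨k, x, hx, by simpa using hk⟩
    · rintro ⟨k, x, hx, -⟩
      exact ⟨x, hx⟩
  rw [this]
  let _ := fellMeasurableSpace n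
  exact MeasurableSet.iUnion fun k => measurableSet_hitting (isCompact_closedBall _ _)

theorem measurable_power (w : E n) : Measurable (power w) := by
  unfold power
  fun_prop

theorem continuous_power (p : E n × ℝ) : Continuous fun w => power w p := by
  unfold power
  fun_prop

/-- On a compact set, countably many power constraints can be satisfied simultaneously as soon as
each finite number of them can be satisfied approximately on a dense subset. -/
theorem laguerreCell_mem_hitting_iff {ι : Type*} [Encodable ι] {K : Set (E n)} (hK : IsCompact K)
    {D : Set (E n)} (hDK : D ⊆ K) (hKD : K ⊆ closure D) (p : E n × ℝ) {X : Set (E n × ℝ)}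
    (q : ι → E n × ℝ) (I : Set ι) (hq : X = q '' I) :
    laguerreCell p X ∈ hitting K ↔ ∀ k : ℕ, ∃ w ∈ D, ∀ j, Encodable.encode j < k → j ∈ I →
      power w p < power w (q j) + 1 / (k + 1) := by
  subst hq
  constructor
  · rintro ⟨w, hw, hwK⟩ k
    have hopen : IsOpen {w | ∀ j ∈ Encodable.encode ⁻¹' Set.Iio k, j ∈ I →
        power w p < power w (q j) + 1 / (k + 1)} := by
      simp only [Set.ofPred_forall]
      refine ((Set.finite_Iio k).preimage
        Encodable.encode_injective.injOn).isOpen_biInter fun j _ => ?_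
      by_cases hj : j ∈ I
      · simpa [hj] using
          isOpen_lt (continuous_power p) ((continuous_power (q j)).add continuous_const)
      · simp [hj]
    have hw' : w ∈ {w | ∀ j ∈ Encodable.encode ⁻¹' Set.Iio k, j ∈ I →
        power w p < power w (q j) + 1 / (k + 1)} := by
      intro j _ hj
      have h1 := hw (q j) ⟨j, hj, rfl⟩
      have : (0 : ℝ) < 1 / (k + 1) := by positivity
      linarith
    obtain ⟨v, hv, hvD⟩ := mem_closure_iff.1 (hKD hwK) _ hopen hw'
    exact ⟨v, hvD, hv⟩
  -- The witnesses accumulate at a point of `K`. Along the subsequence each constraint is eventually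
  -- imposed, and its slack `1 / (k + 1)` vanishes.
  · intro h
    choose w hwD hw using h
    obtain ⟨a, haK, φ, hφ, hlim⟩ := hK.tendsto_subseq fun k => hDK (hwD k)
    refine ⟨a, ?_, haK⟩
    rintro _ ⟨j, hj, rfl⟩
    have h1 := ((continuous_power p).tendsto a).comp hlim
    have h2 := (((continuous_power (q j)).tendsto a).comp hlim).add
      (tendsto_one_div_add_atTop_nhds_zero_nat.comp hφ.tendsto_atTop)
    rw [add_zero] at h2
    refine le_of_tendsto_of_tendsto h1 h2 ?_
    filter_upwards [Filter.eventually_gt_atTop (Encodable.encode j)] with k hk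
    exact (hw (φ k) j (hk.trans_le hφ.le_apply) hj).le

theorem measurable_laguerreCell {ι : Type*} [Encodable ι] {X : Ω → Set (E n × ℝ)}
    {p : Ω → E n × ℝ} {q : ι → Ω → E n × ℝ} {D : ι → Set Ω} (hp : Measurable p)
    (hq : ∀ j, Measurable (q j)) (hD : ∀ j, MeasurableSet (D j))
    (hX : ∀ ω, X ω = (fun j => q j ω) '' {j | ω ∈ D j}) :
    Measurable[_, fellMeasurableSpace n] fun ω => laguerreCell (p ω) (X ω) := by
  refine measurable_generateFrom ?_
  rintro _ ⟨K, hK, rfl⟩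
  obtain ⟨C, hCK, hC, hKC⟩ :=
    (IsSeparable.of_separableSpace K).exists_countable_dense_subset
  have : (fun ω => laguerreCell (p ω) (X ω)) ⁻¹' hitting K = ⋂ k : ℕ, ⋃ w ∈ C, ⋂ j : ι,
      {ω | Encodable.encode j < k → ω ∈ D j →
        power w (p ω) < power w (q j ω) + 1 / (k + 1)} := by
    ext ω
    rw [Set.mem_preimage, laguerreCell_mem_hitting_iff hK hCK hKC (p ω) _ _ (hX ω)]
    simp
  change MeasurableSet ((fun ω => laguerreCell (p ω) (X ω)) ⁻¹' hitting K)
  rw [this]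
  refine MeasurableSet.iInter fun k => MeasurableSet.biUnion hC fun w _ =>
    MeasurableSet.iInter fun j => ?_
  refine (MeasurableSet.const _).imp ((hD j).imp ?_)
  exact measurableSet_lt ((measurable_power w).comp hp)
    (((measurable_power w).comp (hq j)).add_const _)

theorem measurable_of_natCast_le {f : Ω → ℕ∞} (h : ∀ k : ℕ, MeasurableSet {ω | (k : ℕ∞) ≤ f ω}) :
    Measurable f := by
  refine measurable_to_countable' fun x => ?_
  induction x using ENat.recTopCoe with
  | top =>
    convert MeasurableSet.iInter h using 1
    ext ω
    simp [ENat.eq_top_iff_forall_ge]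
  | coe k =>
    convert (h k).diff (h (k + 1)) using 1
    ext ω
    simp only [Set.mem_preimage, Set.mem_singleton_iff, Set.mem_sdiff, Set.mem_ofPred_eq, not_le,
      Nat.cast_add, Nat.cast_one, ENat.lt_natCast_add_one_iff]
    exact ⟨fun h => ⟨h.ge, h.le⟩, fun h => le_antisymm h.2 h.1⟩

/-- The number of distinct values of countably many partially defined random closed sets. -/
theorem measurable_encard_image {ι : Type*} [Countable ι] {F : ι → Ω → Closeds (E n)}
    {D : ι → Set Ω} (hF : ∀ i, Measurable[_, fellMeasurableSpace n] (F i))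
    (hD : ∀ i, MeasurableSet (D i)) :
    Measurable fun ω => ((fun i => F i ω) '' {i | ω ∈ D i}).encard := by
  have hge : ∀ k : ℕ, MeasurableSet {ω | (k : ℕ∞) ≤ ((fun i => F i ω) '' {i | ω ∈ D i}).encard} := by
    intro k
    -- There are at least `k` values iff some `k` active indices have pairwise distinct values.
    -- There are only countably many finite index sets.
    have : {ω | (k : ℕ∞) ≤ ((fun i => F i ω) '' {i | ω ∈ D i}).encard} =
        ⋃ s : {s : Finset ι // s.card = k}, ⋂ i : ι, ⋂ j : ι,
          {ω | i ∈ s.1 → ω ∈ D i ∧ (j ∈ s.1 → F i ω = F j ω → i = j)} := by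
      ext ω
      simp only [Set.mem_ofPred_eq, Set.mem_iUnion, Set.mem_iInter]
      constructor
      · intro h
        obtain ⟨t, ht, htk⟩ := Set.exists_subset_encard_eq h
        obtain ⟨u, hu, hinj⟩ := Set.SurjOn.exists_bijOn_subset (show Set.SurjOn
          (fun i => F i ω) {i | ω ∈ D i} t from ht)
        have huk : u.encard = k := by rw [← htk, ← hinj.image_eq, hinj.injOn.encard_image]
        have hfin : u.Finite := Set.finite_of_encard_eq_coe huk
        refine ⟨⟨hfin.toFinset, ?_⟩, fun i j hi => ⟨hu (by simpa using hi), fun hj hij =>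
          hinj.injOn (by simpa using hi) (by simpa using hj) hij⟩⟩
        rw [hfin.encard_eq_coe_toFinset_card] at huk
        exact_mod_cast huk
      · rintro ⟨⟨s, rfl⟩, hs⟩
        have hinj : Set.InjOn (fun i => F i ω) s := fun i hi j hj hij => (hs i j hi).2 hj hij
        rw [← Set.encard_coe_eq_coe_finsetCard, ← hinj.encard_image]
        exact Set.encard_le_encard (Set.image_mono fun i hi => (hs i i hi).1)
    rw [this]
    refine MeasurableSet.iUnion fun s => MeasurableSet.iInter fun i => MeasurableSet.iInter fun j =>
      (MeasurableSet.const _).imp ((hD i).inter ?_)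
    exact (MeasurableSet.const _).imp
      ((measurableSet_eq_closeds (hF i) (hF j)).imp (MeasurableSet.const _))
  exact measurable_of_natCast_le hge

end Fell

/-! ### Measurability of the Laguerre diagram. -/

section LaguerreDiagram

variable {n : ℕ}

theorem measurable_mosaic {Ω : Type*} [MeasurableSpace Ω] {T : Ω → Mosaic n}
    (h : ∀ A, MeasurableSet[fellMeasurableSpace n] A →
      Measurable fun ω => ((T ω).cells ∩ A).encard) : Measurable T := by
  refine Measurable.of_comap_le ?_
  change MeasurableSpace.comap T (⨆ A, _) ≤ _
  rw [MeasurableSpace.comap_iSup]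
  refine iSup_le fun A => ?_
  rw [MeasurableSpace.comap_comp]
  exact (h A.1 A.2).comap_le

theorem measurable_laguerreDiagram :
    Measurable fun X : Configuration (E n × ℝ) => laguerreDiagram X.carrier := by
  -- A Borel embedding into `ℝ` serves as the injective coordinate for the enumeration.
  set e := embeddingReal (E n × ℝ)
  have he : MeasurableEmbedding e := measurableEmbedding_embeddingReal _
  set F : ℕ × ℚ → Configuration (E n × ℝ) → Closeds (E n) := fun i X =>
    laguerreCell (pointAt 0 e i X) X.carrier
  have hF : ∀ i, Measurable[_, fellMeasurableSpace n] (F i) := fun i =>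
    measurable_laguerreCell (measurable_pointAt 0 he i) (measurable_pointAt 0 he)
      (measurableSet_hit_shellAbove 0 he.measurable) (carrier_eq_image_pointAt 0 he.injective)
  refine measurable_mosaic fun A hA => ?_
  have hcells : ∀ X : Configuration (E n × ℝ), (laguerreDiagram X.carrier).cells ∩ A =
      (fun i => F i X) '' {i | X ∈ {X | (X.carrier ∩ shellAbove 0 e i).Nonempty} ∩
        (F i ⁻¹' {C | (C : Set (E n)).Nonempty} ∩ F i ⁻¹' A)} := by
    intro X
    have hX := carrier_eq_image_pointAt 0 he.injective X
    ext C
    constructor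
    · rintro ⟨⟨hne, p, hp, rfl⟩, hCA⟩
      rw [hX] at hp
      obtain ⟨i, hi, rfl⟩ := hp
      exact ⟨i, ⟨hi, hne, hCA⟩, rfl⟩
    · rintro ⟨i, ⟨hi, hne, hCA⟩, rfl⟩
      exact ⟨⟨hne, _, (pointAt_mem 0 he.injective i X hi).1.1, rfl⟩, hCA⟩
  simp only [hcells]
  exact measurable_encard_image hF fun i => (measurableSet_hit_shellAbove 0 he.measurable i).inter
    ((hF i measurableSet_nonempty_closeds).inter (hF i hA))

end LaguerreDiagram

/-! ### Sections of Voronoi diagrams as Laguerre diagrams. -/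

section Section

variable {l m : ℕ}

theorem finAddEquivProd_embed (w : E l) :
    EuclideanSpace.finAddEquivProd (𝕜 := ℝ) (embed l (l + m) w) = (w, (0 : E m)) := by
  ext i <;> simp [embed]

theorem norm_sq_finAddEquivProd (x : E (l + m)) :
    ‖x‖ ^ 2 = ‖(EuclideanSpace.finAddEquivProd (𝕜 := ℝ) x).1‖ ^ 2 +
      ‖(EuclideanSpace.finAddEquivProd (𝕜 := ℝ) x).2‖ ^ 2 := by
  refine Eq.trans ?_
    (WithLp.prod_norm_sq_eq_of_L2 (WithLp.toLp 2 (EuclideanSpace.finAddEquivProd (𝕜 := ℝ) x)))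
  congr 1
  rw [← (LinearIsometryEquiv.piLpCongrLeft 2 ℝ ℝ finSumFinEquiv.symm).norm_map x,
    ← (PiLp.sumPiLpEquivProdLpPiLp (𝕜 := ℝ) 2 (fun _ : Fin l ⊕ Fin m => ℝ)).norm_map]
  rfl

theorem measurePreserving_finAddEquivProd :
    MeasurePreserving (EuclideanSpace.finAddEquivProd (𝕜 := ℝ) : E (l + m) → E l × E m) :=
  (WithLp.volume_preserving_ofLp (E l) (E m)).comp
    ((PiLp.sumPiLpEquivProdLpPiLp 2 (fun _ : Fin l ⊕ Fin m => ℝ)).measurePreserving.comp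
      (LinearIsometryEquiv.piLpCongrLeft 2 ℝ ℝ finSumFinEquiv.symm).measurePreserving)

/-- The weighted point of `ℝ^l` that induces on `ℝ^l` the power function `w ↦ ‖x - w‖ ^ 2`. -/
noncomputable def weightedPoint (l m : ℕ) (x : E (l + m)) : E l × ℝ :=
  ((EuclideanSpace.finAddEquivProd (𝕜 := ℝ) x).1, ‖(EuclideanSpace.finAddEquivProd (𝕜 := ℝ) x).2‖ ^ 2)

theorem continuous_weightedPoint : Continuous (weightedPoint l m) := by
  unfold weightedPoint
  fun_prop

theorem power_weightedPoint (w : E l) (x : E (l + m)) :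
    power w (weightedPoint l m x) = ‖x - embed l (l + m) w‖ ^ 2 := by
  rw [norm_sq_finAddEquivProd, map_sub, finAddEquivProd_embed, power, weightedPoint, norm_sub_rev]
  simp

theorem sectionMosaic_voronoiDiagram (Y : Set (E (l + m))) :
    sectionMosaic l (voronoiDiagram Y) = laguerreDiagram (weightedPoint l m '' Y) := by
  have key : ∀ x, ((laguerreCell (weightedPoint l m x) (weightedPoint l m '' Y) : Closeds (E l)) :
      Set (E l)) = embed l (l + m) ⁻¹' (voronoiCell x Y : Set (E (l + m))) := by
    intro x
    ext w
    change (∀ q ∈ weightedPoint l m '' Y, power w (weightedPoint l m x) ≤ power w q) ↔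
      ∀ y ∈ Y, ‖x - embed l (l + m) w‖ ≤ ‖y - embed l (l + m) w‖
    rw [Set.forall_mem_image]
    simp only [power_weightedPoint, sq_le_sq₀ (norm_nonneg _) (norm_nonneg _)]
  ext D
  refine and_congr_right fun _ => ⟨?_, ?_⟩
  · rintro ⟨_, ⟨x, hx, rfl⟩, hD⟩
    exact ⟨_, ⟨x, hx, rfl⟩, SetLike.coe_injective (hD.trans (key x).symm)⟩
  · rintro ⟨_, ⟨x, hx, rfl⟩, rfl⟩
    exact ⟨_, ⟨x, hx, rfl⟩, key x⟩

/-- A bound `R` on the image controls `‖v‖² ≤ R²` and `‖u‖² ≤ R`. This keeps the image configuration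
locally finite and the intensities of bounded sets finite. -/
theorem isBounded_preimage_weightedPoint {B : Set (E l × ℝ)} (hB : Bornology.IsBounded B) :
    Bornology.IsBounded (weightedPoint l m ⁻¹' B) := by
  obtain ⟨R, hR⟩ := hB.exists_norm_le
  refine (isBounded_iff_forall_norm_le).2 ⟨Real.sqrt (R ^ 2 + R), fun x hx => ?_⟩
  refine Real.le_sqrt_of_sq_le ?_
  have h := hR _ hx
  rw [Prod.norm_def, max_le_iff] at h
  rw [norm_sq_finAddEquivProd]
  have h2 := (le_abs_self _).trans h.2
  exact add_le_add (pow_le_pow_left₀ (norm_nonneg _) h.1 2) h2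

theorem finite_image_weightedPoint_inter {Y : Set (E (l + m))}
    (hY : ∀ B, Bornology.IsBounded B → (Y ∩ B).Finite) (B : Set (E l × ℝ))
    (hB : Bornology.IsBounded B) : (weightedPoint l m '' Y ∩ B).Finite := by
  rw [← Set.image_inter_preimage]
  exact (hY _ (isBounded_preimage_weightedPoint hB)).image _

end Section

/-! ### The image of Lebesgue measure under the weighting map. -/

section Intensity

open Real

theorem measure_Ioc_map_norm_sq {m : ℕ} (hm : 1 ≤ m) {a b : ℝ} (ha : 0 ≤ a) (hab : a ≤ b) :
    (volume : Measure (E m)).map (fun x => ‖x‖ ^ 2) (Set.Ioc a b) =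
      ENNReal.ofReal (π ^ ((m : ℝ) / 2) / Gamma ((m : ℝ) / 2 + 1) *
        (b ^ ((m : ℝ) / 2) - a ^ ((m : ℝ) / 2))) := by
  have hball : ∀ c : ℝ, 0 ≤ c → (volume : Measure (E m)) (Metric.closedBall 0 (√c)) =
      ENNReal.ofReal (π ^ ((m : ℝ) / 2) / Gamma ((m : ℝ) / 2 + 1) * c ^ ((m : ℝ) / 2)) := by
    intro c hc
    have : Nonempty (Fin m) := ⟨⟨0, hm⟩⟩
    have hpow : ∀ t : ℝ, 0 ≤ t → √t ^ m = t ^ ((m : ℝ) / 2) := fun t ht => by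
      rw [sqrt_eq_rpow, ← rpow_natCast, ← rpow_mul ht]
      ring_nf
    rw [EuclideanSpace.volume_closedBall, Fintype.card_fin, ← ENNReal.ofReal_pow (sqrt_nonneg _),
      ← ENNReal.ofReal_mul (by positivity), hpow c hc, hpow π pi_pos.le, mul_comm]
  have hpre : (fun x : E m => ‖x‖ ^ 2) ⁻¹' Set.Ioc a b =
      Metric.closedBall 0 (√b) \ Metric.closedBall 0 (√a) := by
    ext x
    simp only [Set.mem_preimage, Set.mem_Ioc, Set.mem_sdiff, mem_closedBall_zero_iff, not_le]
    rw [Real.sqrt_lt ha (norm_nonneg _), Real.le_sqrt (norm_nonneg _) (ha.trans hab), and_comm]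
  rw [Measure.map_apply (by fun_prop) measurableSet_Ioc, hpre,
    measure_sdiff (Metric.closedBall_subset_closedBall (sqrt_le_sqrt hab))
      measurableSet_closedBall.nullMeasurableSet measure_closedBall_lt_top.ne,
    hball a ha, hball b (ha.trans hab), ← ENNReal.ofReal_sub _ (by positivity), mul_sub]

/-- The law of the squared norm under Lebesgue measure on `ℝ^m`. -/
theorem map_norm_sq_volume {m : ℕ} (hm : 1 ≤ m) :
    (volume : Measure (E m)).map (fun x => ‖x‖ ^ 2) =
      ((volume : Measure ℝ).restrict (Set.Ici 0)).withDensity fun h =>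
        ENNReal.ofReal (π ^ ((m : ℝ) / 2) / Gamma ((m : ℝ) / 2) * h ^ ((m : ℝ) / 2 - 1)) := by
  have hm0 : (0 : ℝ) < m := by exact_mod_cast hm
  have hG : Gamma ((m : ℝ) / 2 + 1) = m / 2 * Gamma ((m : ℝ) / 2) := Gamma_add_one (by positivity)
  have hGpos : 0 < Gamma ((m : ℝ) / 2) := Gamma_pos_of_pos (by positivity)
  have : Nonempty (Fin m) := ⟨⟨0, hm⟩⟩
  -- Both measures are carried by the positive reals, so interval endpoints may be clipped at `0`,
  -- where the ball volume formula applies.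
  have hcongr : ∀ μ : Measure ℝ, (∀ᵐ x ∂μ, 0 < x) → ∀ a b : ℝ,
      μ (Set.Ioc a b) = μ (Set.Ioc (max a 0) (max b 0)) := by
    intro μ hμ a b
    refine measure_congr ?_
    filter_upwards [hμ] with x hx
    refine propext ?_
    change a < x ∧ x ≤ b ↔ max a 0 < x ∧ x ≤ max b 0
    simp [hx, hx.not_ge]
  have hpos : ∀ᵐ x ∂(volume : Measure (E m)).map (fun x => ‖x‖ ^ 2), 0 < x := by
    rw [ae_map_iff (by fun_prop) measurableSet_Ioi]
    filter_upwards [Measure.ae_ne volume (0 : E m)] with x hx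
    positivity
  have hpos' : ∀ᵐ x ∂((volume : Measure ℝ).restrict (Set.Ici 0)).withDensity fun h =>
      ENNReal.ofReal (π ^ ((m : ℝ) / 2) / Gamma ((m : ℝ) / 2) * h ^ ((m : ℝ) / 2 - 1)), 0 < x := by
    refine (withDensity_absolutelyContinuous _ _).ae_le ?_
    rw [← restrict_Ioi_eq_restrict_Ici]
    exact ae_restrict_mem measurableSet_Ioi
  refine Measure.ext_of_Ioc' _ _ (fun a b _ => ?_) fun a b hab => ?_
  · rw [hcongr _ hpos, measure_Ioc_map_norm_sq hm (le_max_right _ _)]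
    · exact ENNReal.ofReal_ne_top
    · exact max_le_max_right _ (by linarith)
  · have hab' : max a 0 ≤ max b 0 := max_le_max_right _ hab.le
    have hinter : Set.Ioc (max a 0) (max b 0) ∩ Set.Ici 0 = Set.Ioc (max a 0) (max b 0) :=
      Set.inter_eq_left.2 fun x hx => (le_max_right a 0).trans hx.1.le
    rw [hcongr _ hpos, hcongr _ hpos', measure_Ioc_map_norm_sq hm (le_max_right _ _) hab',
      withDensity_apply _ measurableSet_Ioc, Measure.restrict_restrict measurableSet_Ioc,
      hinter,
      ← ofReal_integral_eq_lintegral_ofReal, ← intervalIntegral.integral_of_le hab',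
      intervalIntegral.integral_const_mul, integral_rpow (Or.inl (by linarith)), sub_add_cancel, hG]
    · congr 1
      field_simp
    · rw [← IntegrableOn, ← intervalIntegrable_iff_integrableOn_Ioc_of_le hab']
      exact (intervalIntegral.intervalIntegrable_rpow' (by linarith)).const_mul _
    · filter_upwards [ae_restrict_mem measurableSet_Ioc] with x hx
      have := (le_max_right a 0).trans hx.1.le
      positivity

theorem map_weightedPoint {l m : ℕ} (hm : 1 ≤ m) {ρ : ℝ} (hρ : 0 < ρ) :
    (ENNReal.ofReal ρ • (volume : Measure (E (l + m)))).map (weightedPoint l m) =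
      betaIntensity l ((m : ℝ) / 2 - 1)
        (π ^ (((l : ℝ) + m + 1) / 2) * ρ / Gamma (((l : ℝ) + m + 1) / 2)) := by
  have h1 : weightedPoint l m = Prod.map id (fun x : E m => ‖x‖ ^ 2) ∘
      EuclideanSpace.finAddEquivProd (𝕜 := ℝ) := rfl
  -- For `β = m / 2 - 1` the numerator of `betaConst (l + 1) β` is `Γ((l + m + 1) / 2)`, which
  -- cancels the denominator of `γ`. The surviving power of `π` is `π ^ (m / 2)`.
  have hc : ∀ h : ℝ, π ^ (((l : ℝ) + m + 1) / 2) * ρ / Gamma (((l : ℝ) + m + 1) / 2) *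
      betaConst (l + 1) ((m : ℝ) / 2 - 1) * h ^ ((m : ℝ) / 2 - 1) =
      ρ * (π ^ ((m : ℝ) / 2) / Gamma ((m : ℝ) / 2) * h ^ ((m : ℝ) / 2 - 1)) := by
    intro h
    have hm0 : (0 : ℝ) < m := by exact_mod_cast hm
    have hGpos : 0 < Gamma ((m : ℝ) / 2) := Gamma_pos_of_pos (by positivity)
    have hGpos' : 0 < Gamma (((l : ℝ) + m + 1) / 2) := Gamma_pos_of_pos (by positivity)
    have e1 : ((l : ℝ) + 1) / 2 + ((m : ℝ) / 2 - 1) + 1 = ((l : ℝ) + m + 1) / 2 := by ring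
    have e2 : ((l : ℝ) + m + 1) / 2 = ((l : ℝ) + 1) / 2 + m / 2 := by ring
    have e3 : π ^ (((l : ℝ) + m + 1) / 2) = π ^ (((l : ℝ) + 1) / 2) * π ^ ((m : ℝ) / 2) := by
      rw [e2, rpow_add pi_pos]
    rw [betaConst]
    push_cast
    rw [e1, e3, sub_add_cancel]
    field_simp
  rw [Measure.map_smul, h1, ← Measure.map_map (by fun_prop) (by fun_prop),
    measurePreserving_finAddEquivProd.map_eq, Measure.volume_eq_prod,
    ← Measure.map_prod_map _ _ measurable_id (by fun_prop), Measure.map_id, map_norm_sq_volume hm,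
    prod_withDensity_right (by fun_prop), ← withDensity_smul _ (by fun_prop), betaIntensity,
    Measure.volume_eq_prod, ← Measure.prod_restrict, Measure.restrict_univ]
  congr 1
  ext p
  simp only [Pi.smul_apply, smul_eq_mul, hc]
  rw [ENNReal.ofReal_mul hρ.le]

end Intensity

end SectionTess

/-! ### Equality in law of the two tessellations. -/

theorem mainTheorem2 (d l : ℕ) (hd : 2 ≤ d) (hl : 1 ≤ l) (hld : l ≤ d - 1) (ρ : ℝ) (hρ : 0 < ρ)
    {Ω Ω' : Type*} [MeasurableSpace Ω] [MeasurableSpace Ω']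
    (P : Measure Ω) [IsProbabilityMeasure P] (P' : Measure Ω') [IsProbabilityMeasure P']
    (W : Ω → SectionTess.Mosaic d) (hW : SectionTess.IsPoissonVoronoi d ρ W P)
    (V : Ω' → SectionTess.Mosaic l)
    (hV : SectionTess.IsBetaVoronoi l (((d : ℝ) - (l : ℝ)) / 2 - 1)
      (Real.pi ^ (((d : ℝ) + 1) / 2) * ρ / Real.Gamma (((d : ℝ) + 1) / 2)) V P') :
    IdentDistrib (fun ω => SectionTess.sectionMosaic l (W ω)) V P P' := by
  obtain ⟨m, rfl⟩ := Nat.exists_eq_add_of_le (show l ≤ d by omega)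
  obtain ⟨ζ, hζ, hW⟩ := hW
  obtain ⟨η, hη, hV⟩ := hV
  push_cast at hη
  rw [add_sub_cancel_left, ← SectionTess.map_weightedPoint (by omega) hρ] at hη
  have hf : Measurable (SectionTess.weightedPoint l m) :=
    SectionTess.continuous_weightedPoint.measurable
  have hζf : ∀ ω, ∀ B : Set (SectionTess.E l × ℝ), Bornology.IsBounded B →
      (SectionTess.weightedPoint l m '' ζ ω ∩ B).Finite := fun ω =>
    SectionTess.finite_image_weightedPoint_inter (hζ.finite_inter ω)
  have hY : Measurable fun ω =>
      (⟨η ω, hη.finite_inter ω⟩ : SectionTess.Configuration (SectionTess.E l × ℝ)) := by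
    simpa only [Set.image_id] using hη.toIsPointProcess.measurable_image measurable_id
      (by simpa only [Set.image_id] using hη.finite_inter)
  have h := (SectionTess.identDistrib_of_void (P := P) (P' := P')
    (hζ.toIsPointProcess.measurable_image hf hζf) hY fun B hB hb => ?_).comp
      SectionTess.measurable_laguerreDiagram
  · convert h using 1
    · funext ω
      rw [hW, SectionTess.sectionMosaic_voronoiDiagram]
      rfl
    · exact funext hV
  · have hfin : (ENNReal.ofReal ρ • (volume : Measure (SectionTess.E (l + m))))
        (SectionTess.weightedPoint l m ⁻¹' B) ≠ ⊤ := by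
      rw [Measure.smul_apply, smul_eq_mul]
      exact ENNReal.mul_ne_top ENNReal.ofReal_ne_top
        (SectionTess.isBounded_preimage_weightedPoint hb).measure_lt_top.ne
    -- Both void probabilities are the exponential of minus the intensity of the preimage of `B`.
    have hmap := Measure.map_apply (μ := ENNReal.ofReal ρ • (volume : Measure _)) hf hB
    rw [hη.measure_void hB (by rwa [hmap]), hmap, ← hζ.measure_void (hf hB) hfin]
    congr 1
    ext ω
    simp [Set.eq_empty_iff_forall_notMem]
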